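/- Consider the toric code on a finite lattice drawn on the torus (all faces being discs), with one qubit on each edge. For each face $p$ let $B_p$ be the product of $\sigma^z$ over the edges bounding $p$. Let $W_1^z, W_2^z$ be products of $\sigma^z$ along closed loops of the lattice in two independent non-contractible directions, called $1$ and $2$, and let $W_1^x, W_2^x$ be products of $\sigma^x$ along closed loops of the dual lattice, where $W_i^x$ is parallel to $W_i^z$: the loops of $W_1^x$ and $W_2^z$, and those of $W_2^x$ and $W_1^z$, cross an odd number of times, while for $i=1,2$ the loops of $W_i^x$ and $W_i^z$ cross an even number of times. The ground states of definite flux are $$|\psi_I\rangle = N \prod_{p}\frac{1+B_p}{2}\;\frac{1+W_1^z}{2}\;|{+}\cdots{+}\rangle,\qquad |\psi_e\rangle = W_2^x|\psi_I\rangle,\qquad |\psi_m\rangle = W_2^z|\psi_I\rangle,\qquad |\psi_{em}\rangle = W_2^xW_2^z|\psi_I\rangle,$$ where $N>0$ normalizes $|\psi_I\rangle$. Let the set of edges be the disjoint union of two regions $A$ and $B$, each of them connected (through edges that are consecutive around a vertex) and non-contractible in direction $1$ (the loop of $W_1^z$ can be deformed into it, i.e. the product of $W_1^z$ with suitable operators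 $B_p$ acts on that region only). Suppose that $A$ and $B$ share exactly two boundaries. Here a boundary is a connected component of the set of corners (a face at one of its vertices) whose two edges lie in different regions, corners at the same vertex or in the same face being joined. Let $n_{AB}^{(1)}$ and $n_{AB}^{(2)}$ be the numbers of plaquettes (faces) spanning the first and the second boundary, i.e. containing one of its corners. Then for each $i\in\{I,e,m,em\}$ the logarithmic negativity $E_{\mathcal N}^{A|B}(\rho)=\log_2\operatorname{tr}|\rho^{T_A}|$, where $T_A$ is the partial transpose on $A$ and $|O|=\sqrt{O^\dagger O}$, satisfies $$E_{\mathcal N}^{A|B}\left(|\psi_i\rangle\langle\psi_i|\right) = \left(n_{AB}^{(1)}-1\right)+\left(n_{AB}^{(2)}-1\right).$$ -/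

import Mathlib

namespace ToricCode

/-! ### Qubits, Pauli operators, logarithmic negativity -/

/-- Labels of the computational (`σᶻ`) basis of `(ℂ²)^{⊗ E}`, one qubit per element of `E`. A vector
of `(ℂ²)^{⊗ E}` is a function `Config E → ℂ`, an operator a matrix indexed by `Config E`. -/
abbrev Config (E : Type*) : Type _ := E → Fin 2

/-- The Pauli matrix `σˣ`. -/
def sigmaX : Matrix (Fin 2) (Fin 2) ℂ := !![0, 1; 1, 0]

/-- The Pauli matrix `σᶻ`. -/
def sigmaZ : Matrix (Fin 2) (Fin 2) ℂ := !![1, 0; 0, -1]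

section Qubits

variable {E : Type*} [Fintype E] [DecidableEq E]

/-- The tensor product operator `⨂_e M e` on `(ℂ²)^{⊗ E}`. -/
def tensorOp (M : E → Matrix (Fin 2) (Fin 2) ℂ) : Matrix (Config E) (Config E) ℂ :=
  Matrix.of fun s t => ∏ e, M e (s e) (t e)

theorem tensorOp_mul (M N : E → Matrix (Fin 2) (Fin 2) ℂ) :
    tensorOp M * tensorOp N = tensorOp fun e => M e * N e := by
  ext s t
  simp only [tensorOp, Matrix.mul_apply, Matrix.of_apply, ← Finset.prod_mul_distrib]
  exact (Fintype.prod_sum fun e (k : Fin 2) => M e (s e) k * N e k (t e)).symm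

/-- The product of Pauli operators `∏_e (σᶻ_e)^{n e}`. -/
def pauliZ (n : E → ℕ) : Matrix (Config E) (Config E) ℂ := tensorOp fun e => sigmaZ ^ n e

/-- The product of Pauli operators `∏_e (σˣ_e)^{n e}`. -/
def pauliX (n : E → ℕ) : Matrix (Config E) (Config E) ℂ := tensorOp fun e => sigmaX ^ n e

theorem pauliZ_commute (m n : E → ℕ) : Commute (pauliZ m) (pauliZ n) := by
  simp only [Commute, SemiconjBy, pauliZ, tensorOp_mul]
  congr 1
  funext e
  exact (Commute.pow_pow_self sigmaZ (m e) (n e)).eq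

/-- For an operator `O` with `O² = 1`, the projector `(1 + O) / 2` onto its `+1` eigenspace. -/
noncomputable def projPlus (O : Matrix (Config E) (Config E) ℂ) :
    Matrix (Config E) (Config E) ℂ := (1 / 2 : ℂ) • (1 + O)

theorem projPlus_commute {O O' : Matrix (Config E) (Config E) ℂ} (h : Commute O O') :
    Commute (projPlus O) (projPlus O') := by
  unfold projPlus
  exact (((Commute.one_left _).add_left
    ((Commute.one_right _).add_right h)).smul_left _).smul_right _

/-- The reference state `|+ ⋯ +⟩`, with `|+⟩ = (|0⟩ + |1⟩) / √2`. -/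
noncomputable def plusState : Config E → ℂ := fun _ => ∏ _e : E, ((1 / √2 : ℝ) : ℂ)

/-- The vector `N v`, where `N > 0` is such that `⟨N v | N v⟩ = 1` (for `v ≠ 0`). -/
noncomputable def normalize (v : Config E → ℂ) : Config E → ℂ :=
  ((1 / √(∑ s, ‖v s‖ ^ 2) : ℝ) : ℂ) • v

/-- The operator `|ψ⟩⟨ψ|`. -/
def pureState (ψ : Config E → ℂ) : Matrix (Config E) (Config E) ℂ :=
  Matrix.vecMulVec ψ (star ψ)

/-- The partial transpose `ρ^{T_A}`: the `A`-parts of the row and the column label are exchanged. -/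
def partialTranspose (A : Finset E) (ρ : Matrix (Config E) (Config E) ℂ) :
    Matrix (Config E) (Config E) ℂ :=
  Matrix.of fun s t => ρ (A.piecewise t s) (A.piecewise s t)

open scoped MatrixOrder in
/-- The logarithmic negativity `log₂ tr |ρ^{T_A}|` of a state `ρ` of all the qubits, between `A` and
its complement. Here `CFC.abs O = √(O† O)`. -/
noncomputable def logNegativity (A : Finset E) (ρ : Matrix (Config E) (Config E) ℂ) : ℝ :=
  Real.logb 2 (Matrix.trace (CFC.abs (partialTranspose A ρ))).re

end Qubits

/-! ### Lattices on the torus -/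

/-- A finite lattice drawn on the torus (all its faces being discs), with vertices `V`, edges `E`,
faces `F`, given as a combinatorial map. `D` is the set of darts (an edge together with one of its
two orientations); `rot d` is the next dart counterclockwise around the vertex that `d` leaves,
`rev d` is `d` reversed, `face d` is the face on the left of `d`; going around that face, `d` is
followed by `rot⁻¹ (rev d)`. Loops and multiple edges are allowed. A connected such surface is
oriented and closed, hence is a torus exactly when its Euler characteristic vanishes. -/
structure TorusLattice (V E F D : Type*) [Fintype V] [Fintype E] [Fintype F] where
  rot : Equiv.Perm D
  rev : Equiv.Perm D
  rev_rev : ∀ d, rev (rev d) = d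
  rev_ne : ∀ d, rev d ≠ d
  vert : D → V
  edge : D → E
  face : D → F
  vert_surjective : Function.Surjective vert
  edge_surjective : Function.Surjective edge
  face_surjective : Function.Surjective face
  vert_eq_iff : ∀ d d', vert d = vert d' ↔ rot.SameCycle d d'
  edge_eq_iff : ∀ d d', edge d = edge d' ↔ d' = d ∨ d' = rev d
  face_eq_iff : ∀ d d', face d = face d' ↔ (rot⁻¹ * rev).SameCycle d d'
  nonempty : Nonempty D
  connected : MulAction.IsPretransitive (Subgroup.closure {rot, rev} : Subgroup (Equiv.Perm D)) D
  euler : Fintype.card V + Fintype.card F = Fintype.card E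

namespace TorusLattice

variable {V E F D : Type*} [Fintype V] [DecidableEq V] [Fintype E] [DecidableEq E]
  [Fintype F] [DecidableEq F] [Fintype D] [DecidableEq D]

/-- Directions `1` and `2` on the torus. `z₁`, `z₂` are the supports of closed loops on the lattice,
`x₁`, `x₂` those of closed loops on the dual lattice (as cycles modulo 2); `x₁` is parallel to `z₁`
and crosses `z₂`, and `x₂` is parallel to `z₂` and crosses `z₁`. The crossing conditions force `z₁`
and `z₂` to be non-contractible and independent, and likewise `x₁` and `x₂`. -/
structure Loops (T : TorusLattice V E F D) where
  z₁ : Finset E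
  z₂ : Finset E
  x₁ : Finset E
  x₂ : Finset E
  z₁_closed : ∀ s : V, Even (Finset.card {d : D | T.vert d = s ∧ T.edge d ∈ z₁})
  z₂_closed : ∀ s : V, Even (Finset.card {d : D | T.vert d = s ∧ T.edge d ∈ z₂})
  x₁_closed : ∀ p : F, Even (Finset.card {d : D | T.face d = p ∧ T.edge d ∈ x₁})
  x₂_closed : ∀ p : F, Even (Finset.card {d : D | T.face d = p ∧ T.edge d ∈ x₂})
  even_x₁_z₁ : Even (x₁ ∩ z₁).card
  odd_x₁_z₂ : Odd (x₁ ∩ z₂).card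
  odd_x₂_z₁ : Odd (x₂ ∩ z₁).card
  even_x₂_z₂ : Even (x₂ ∩ z₂).card

/-- The plaquette operator `B_p`, the product of `σᶻ` along the boundary of the face `p` (an edge
with `p` on both sides is passed twice). -/
def plaquetteOp (T : TorusLattice V E F D) (p : F) : Matrix (Config E) (Config E) ℂ :=
  pauliZ fun e => Finset.card {d : D | T.edge d = e ∧ T.face d = p}

/-- The loop operator `∏_{e ∈ ℓ} σᶻ_e`. -/
def loopZ (ℓ : Finset E) : Matrix (Config E) (Config E) ℂ :=
  pauliZ fun e => if e ∈ ℓ then 1 else 0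

/-- The loop operator `∏_{e ∈ ℓ} σˣ_e`. -/
def loopX (ℓ : Finset E) : Matrix (Config E) (Config E) ℂ :=
  pauliX fun e => if e ∈ ℓ then 1 else 0

/-- The projector `∏_p (1 + B_p) / 2`. The factors commute, and since `∏_p B_p = 1` the product over
all faces equals the product over all faces but one, that is, over a maximal independent set. -/
noncomputable def plaquetteProj (T : TorusLattice V E F D) : Matrix (Config E) (Config E) ℂ :=
  Finset.univ.noncommProd (fun p : F => projPlus (T.plaquetteOp p))
    fun _ _ _ _ _ => projPlus_commute (pauliZ_commute _ _)

/-- The ground state `N ∏_p ((1 + B_p) / 2) ((1 + W₁ᶻ) / 2) |+ ⋯ +⟩`. -/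
noncomputable def groundStateI (T : TorusLattice V E F D) (W : T.Loops) : Config E → ℂ :=
  normalize ((T.plaquetteProj * projPlus (loopZ W.z₁)).mulVec plusState)

end TorusLattice

/-- The anyon fluxes of the toric code. -/
inductive Flux
  | I
  | e
  | m
  | em

namespace TorusLattice

variable {V E F D : Type*} [Fintype V] [DecidableEq V] [Fintype E] [DecidableEq E]
  [Fintype F] [DecidableEq F] [Fintype D] [DecidableEq D]

/-- The four ground states of definite flux: `|ψ_I⟩`, `|ψ_e⟩ = W₂ˣ |ψ_I⟩`, `|ψ_m⟩ = W₂ᶻ |ψ_I⟩`,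
`|ψ_em⟩ = W₂ˣ W₂ᶻ |ψ_I⟩`. -/
noncomputable def fluxState (T : TorusLattice V E F D) (W : T.Loops) : Flux → Config E → ℂ
  | .I => T.groundStateI W
  | .e => (loopX W.x₂).mulVec (T.groundStateI W)
  | .m => (loopZ W.z₂).mulVec (T.groundStateI W)
  | .em => (loopX W.x₂ * loopZ W.z₂).mulVec (T.groundStateI W)

/-- Two edges are neighbours if they are consecutive around some vertex, equivalently consecutive
around some face. -/
def neighbourGraph (T : TorusLattice V E F D) : SimpleGraph E :=
  SimpleGraph.fromRel fun e e' => ∃ d, T.edge d = e ∧ T.edge (T.rot d) = e'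

/-- The loop `ℓ` can be deformed into the region `A`: some product of the loop operator of `ℓ` with
plaquette operators `B_p`, `p ∈ P`, acts only on `A`. -/
def DeformsInto (T : TorusLattice V E F D) (ℓ A : Finset E) : Prop :=
  ∃ P : Finset F, ∀ e, e ∉ A →
    Even ((if e ∈ ℓ then 1 else 0) + Finset.card {d : D | T.edge d = e ∧ T.face d ∈ P})

/-- `A` is a connected region which is non-contractible in the direction of the loop `ℓ`. -/
structure IsNonContractibleRegion (T : TorusLattice V E F D) (ℓ A : Finset E) : Prop where
  connected : (T.neighbourGraph.induce (A : Set E)).Connected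
  loop : T.DeformsInto ℓ A

/-- The boundary between `A` and its complement crosses the corner (of the face `face d` at the
vertex `vert d`) between the consecutive edges of `d` and `rot d`. -/
def IsCrossed (T : TorusLattice V E F D) (A : Finset E) (d : D) : Prop :=
  ¬(T.edge d ∈ A ↔ T.edge (T.rot d) ∈ A)

/-- The crossed corners, two of them being joined if they lie at the same vertex or in the same
face. The boundary between `A` and its complement runs alternately through vertices and faces, from
one to the next through a crossed corner; so the connected components of this graph are the
connected components of the boundary. -/
def boundaryGraph (T : TorusLattice V E F D) (A : Finset E) :
    SimpleGraph {d : D // T.IsCrossed A d} :=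
  SimpleGraph.fromRel fun d d' =>
    T.vert (d : D) = T.vert (d' : D) ∨ T.face (d : D) = T.face (d' : D)

/-- The number of plaquettes which span the component `Γ` of the boundary. -/
noncomputable def numPlaquettes (T : TorusLattice V E F D) (A : Finset E)
    (Γ : (T.boundaryGraph A).ConnectedComponent) : ℕ :=
  Set.ncard {p : F | ∃ d ∈ Γ.supp, T.face (d : D) = p}

end TorusLattice

end ToricCode

/-! Up to a product of single-edge signs, each of the four states is a uniform superposition over a
coset of the space K of 𝔽₂-chains with no flux through any face or along `z₁`; `W₂ᶻ` changes only
the signs and `W₂ˣ` only moves the coset (`exists_isCosetState`). Let L ⊆ K be the chains whose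
parts in A and in B both lie in K. The partial transpose H satisfies H³ = μ²H with μ = |L|/|K|, and
tr H² = 1, so tr |H| = |K|/|L| (`IsCosetState.logNegativity_eq`).

Both sizes come from counting relations among the checks (faces and loop). On all edges the only
nontrivial relation is the sum of all faces, so log₂|K| = |E| - |F|. For L every check is imposed on
A and on B separately. Among the checks cut down to A the relations have dimension 2 + a, where a
faces have no edge in A: the coefficient of the loop is free because the loop deforms into B, the
faces along A share one coefficient (corrected by that deformation) because A is connected, and the
other a faces are free. Likewise 2 + b for B (`card_restrict_vecMul_eq_zero`). Hence log₂(|K|/|L|) =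
|F| - a - b - 2, and |F| - a - b counts the faces meeting both regions, which are the plaquettes of
the two boundaries. -/

namespace ToricCode

/-! ### Counting null vectors over 𝔽₂. -/

section LinearAlgebra

theorem card_ker_mul_two_pow_rank {m n : Type*} [Fintype m] [Fintype n]
    (M : Matrix m n (ZMod 2)) :
    Nat.card {s : n → ZMod 2 // M.mulVec s = 0} * 2 ^ M.rank = 2 ^ Fintype.card n := by
  have h1 : Nat.card {s : n → ZMod 2 // M.mulVec s = 0} =
      2 ^ Module.finrank (ZMod 2) (LinearMap.ker M.mulVecLin) := by
    have := Module.natCard_eq_pow_finrank (K := ZMod 2) (V := LinearMap.ker M.mulVecLin)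
    rw [Nat.card_zmod] at this
    rw [← this]
    exact Nat.card_congr (Equiv.subtypeEquivRight fun s => by simp)
  have h2 := M.mulVecLin.finrank_range_add_finrank_ker
  rw [h1, ← pow_add, Matrix.rank, add_comm, h2, Module.finrank_pi]

/-- The spaces of null vectors of a matrix over `𝔽₂` on the two sides determine each other's size. -/
theorem card_ker_mul_two_pow {m n : Type*} [Fintype m] [Fintype n]
    (M : Matrix m n (ZMod 2)) :
    Nat.card {s : n → ZMod 2 // M.mulVec s = 0} * 2 ^ Fintype.card m =
      Nat.card {P : m → ZMod 2 // M.vecMul P = 0} * 2 ^ Fintype.card n := by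
  classical
  have h1 := card_ker_mul_two_pow_rank M
  have h2 := card_ker_mul_two_pow_rank M.transpose
  simp only [Matrix.rank_transpose, Matrix.mulVec_transpose] at h2
  rw [← h1, ← h2]
  ring

end LinearAlgebra

/-! ### Trace norm from a cubic equation. -/

section TraceNorm

open scoped MatrixOrder ComplexOrder in
/-- If `H` is hermitian with eigenvalues in `{0, μ, -μ}`, then `|H| = H² / μ`. -/
theorem trace_abs_of_cube_eq {n : Type*} [Fintype n] [DecidableEq n] {H : Matrix n n ℂ}
    (hH : H.IsHermitian) {μ : ℝ} (hμ : 0 < μ) (h : H * H * H = ((μ ^ 2 : ℝ) : ℂ) • H) :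
    Matrix.trace (CFC.abs H) = ((μ⁻¹ : ℝ) : ℂ) * Matrix.trace (H * H) := by
  have hs : star H = H := hH
  have hpos : 0 ≤ ((μ⁻¹ : ℝ) : ℂ) • (H * H) := by
    have h1 : (H * H).PosSemidef := by
      have := Matrix.posSemidef_conjTranspose_mul_self H
      rwa [hH.eq] at this
    refine Matrix.nonneg_iff_posSemidef.2 (h1.smul ?_)
    exact_mod_cast (inv_pos.2 hμ).le
  have habs : CFC.abs H = ((μ⁻¹ : ℝ) : ℂ) • (H * H) := by
    rw [CFC.abs, hs]
    -- The cubic equation gives (H²/μ)² = H³H/μ² = H², and H²/μ is positive.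
    refine CFC.sqrt_unique ?_ hpos
    rw [smul_mul_smul_comm, ← mul_assoc, h, smul_mul_assoc, smul_smul]
    have : ((μ⁻¹ : ℝ) : ℂ) * ((μ⁻¹ : ℝ) : ℂ) * ((μ ^ 2 : ℝ) : ℂ) = 1 := by
      have : μ⁻¹ * μ⁻¹ * μ ^ 2 = 1 := by field_simp
      exact_mod_cast this
    rw [this, one_smul]
  rw [habs, Matrix.trace_smul, smul_eq_mul]

end TraceNorm

/-! ### Negativity of coset states. -/

section CosetStates

set_option linter.unusedSectionVars false

variable {E : Type*} [Fintype E] [DecidableEq E]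

/-- A configuration, read as a chain with coefficients in `𝔽₂`. -/
def toChain : Config E ≃ (E → ZMod 2) := Equiv.refl _

/-- The restriction of chains to a region. -/
def restrict (A : Finset E) : (E → ZMod 2) →ₗ[ZMod 2] (E → ZMod 2) where
  toFun s := fun e => if e ∈ A then s e else 0
  map_add' s t := by ext e; by_cases h : e ∈ A <;> simp [h]
  map_smul' c s := by ext e; by_cases h : e ∈ A <;> simp [h]

theorem restrict_apply (A : Finset E) (s : E → ZMod 2) (e : E) :
    restrict A s e = if e ∈ A then s e else 0 := rfl

theorem restrict_compl (A : Finset E) (s : E → ZMod 2) :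
    restrict Aᶜ s = s - restrict A s := by
  ext e; by_cases h : e ∈ A <;> simp [restrict_apply, h]

theorem toChain_piecewise (A : Finset E) (s t : Config E) :
    toChain (A.piecewise s t) = restrict A (toChain s) + (toChain t - restrict A (toChain t)) := by
  ext e
  simp only [Pi.add_apply, Pi.sub_apply, restrict_apply]
  by_cases h : e ∈ A
  · simp only [h, if_true, sub_self, add_zero]
    exact A.piecewise_eq_of_mem s t h
  · simp only [h, if_false, sub_zero, zero_add]
    exact A.piecewise_eq_of_notMem s t h

/-- `ψ` is a uniform superposition, up to a product of local signs, over the coset `K - x`. -/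
def IsCosetState (K : Submodule (ZMod 2) (E → ZMod 2)) (κ : ℝ) (ψ : Config E → ℂ) : Prop :=
  ∃ (w : E → Fin 2 → ℝ) (x : E → ZMod 2), (∀ e a, w e a ^ 2 = 1) ∧
    ∀ s, ψ s = ((κ * (∏ e, w e (s e)) * (K : Set (E → ZMod 2)).indicator 1 (toChain s + x) : ℝ) : ℂ)

/-- The chains in `K` which are sums of a chain of `K` in `A` and a chain of `K` outside. -/
def splitPart (K : Submodule (ZMod 2) (E → ZMod 2)) (A : Finset E) :
    Submodule (ZMod 2) (E → ZMod 2) :=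
  K.comap (restrict A) ⊓ K.comap (restrict Aᶜ)

/-- `f a b` says that the configuration equal to a on A and to b elsewhere lies in the coset. The
left side is the support of the path s, u, v, t in the cube of the partial transpose; the right side
decouples u from v, so the sums over them each give |L|. Each membership is a signed sum of
memberships from the other side. -/
theorem swap_mem_iff (K : Submodule (ZMod 2) (E → ZMod 2)) (A : Finset E)
    (x s t u v : E → ZMod 2) :
    let f : (E → ZMod 2) → (E → ZMod 2) → Prop := fun a b =>
      restrict A a + (b - restrict A b) + x ∈ K
    ((f u s ∧ f s u) ∧ (f v u ∧ f u v) ∧ (f t v ∧ f v t)) ↔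
      (f t s ∧ f s t) ∧ u - t ∈ splitPart K A ∧ v - s ∈ splitPart K A := by
  intro f
  simp only [splitPart, Submodule.mem_inf, Submodule.mem_comap, restrict_compl, map_sub, f]
  generalize restrict A s = s'
  generalize restrict A t = t'
  generalize restrict A u = u'
  generalize restrict A v = v'
  constructor
  · rintro ⟨⟨h1, h2⟩, ⟨h3, h4⟩, h5, h6⟩
    refine ⟨⟨?_, ?_⟩, ⟨?_, ?_⟩, ?_, ?_⟩
    · convert K.add_mem (K.sub_mem h5 h4) h1 using 1; abel
    · convert K.add_mem (K.sub_mem h2 h3) h6 using 1; abel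
    · convert K.sub_mem h4 h5 using 1; abel
    · convert K.sub_mem h3 h6 using 1; abel
    · convert K.sub_mem h3 h2 using 1; abel
    · convert K.sub_mem h4 h1 using 1; abel
  · rintro ⟨⟨h1, h2⟩, ⟨h3, h4⟩, h5, h6⟩
    refine ⟨⟨?_, ?_⟩, ⟨?_, ?_⟩, ?_, ?_⟩
    · convert K.add_mem h1 h3 using 1; abel
    · convert K.add_mem h2 h4 using 1; abel
    · convert K.add_mem (K.add_mem h2 h4) h5 using 1; abel
    · convert K.add_mem (K.add_mem h1 h3) h6 using 1; abel
    · convert K.add_mem h1 h6 using 1; abel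
    · convert K.add_mem h2 h5 using 1; abel

theorem sum_indicator_add (K : Submodule (ZMod 2) (E → ZMod 2)) (x : E → ZMod 2) :
    ∑ s : Config E, (K : Set (E → ZMod 2)).indicator (1 : (E → ZMod 2) → ℝ) (toChain s + x) =
      Nat.card K := by
  classical
  refine (Fintype.sum_equiv (toChain.trans (Equiv.addRight x)) _
    ((K : Set (E → ZMod 2)).indicator (1 : (E → ZMod 2) → ℝ)) fun s => rfl).trans ?_
  simp only [Set.indicator_apply, Pi.one_apply, Finset.sum_boole, SetLike.mem_coe]
  rw [Nat.card_eq_fintype_card, Fintype.card_subtype]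

/-- Exchanging the `A`-parts of two configurations. -/
def swapOn (A : Finset E) : Config E × Config E ≃ Config E × Config E where
  toFun q := (A.piecewise q.2 q.1, A.piecewise q.1 q.2)
  invFun q := (A.piecewise q.2 q.1, A.piecewise q.1 q.2)
  left_inv q := by ext e <;> by_cases h : e ∈ A <;> simp [h]
  right_inv q := by ext e <;> by_cases h : e ∈ A <;> simp [h]

theorem partialTranspose_isHermitian (A : Finset E) (ψ : Config E → ℂ) :
    (partialTranspose A (pureState ψ)).IsHermitian := by
  ext s t
  simp [partialTranspose, pureState, Matrix.vecMulVec_apply, mul_comm]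

/-- The products of opposite entries are |ψ|²|ψ|² at the pair with exchanged A-parts; the exchange
is a bijection of pairs, so the double sum factorizes. -/
theorem trace_partialTranspose_sq (A : Finset E) (ψ : Config E → ℂ) :
    Matrix.trace (partialTranspose A (pureState ψ) * partialTranspose A (pureState ψ)) =
      (((∑ s, ‖ψ s‖ ^ 2) ^ 2 : ℝ) : ℂ) := by
  have h : ∀ s t, partialTranspose A (pureState ψ) s t * partialTranspose A (pureState ψ) t s =
      ((‖ψ (A.piecewise t s)‖ ^ 2 * ‖ψ (A.piecewise s t)‖ ^ 2 : ℝ) : ℂ) := by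
    intro s t
    simp only [partialTranspose, pureState, Matrix.vecMulVec_apply, Matrix.of_apply, Pi.star_apply,
      RCLike.star_def]
    push_cast
    rw [← Complex.mul_conj', ← Complex.mul_conj']
    ring
  simp only [Matrix.trace, Matrix.diag_apply, Matrix.mul_apply, h]
  rw [← Fintype.sum_prod_type' fun s t =>
    ((‖ψ (A.piecewise t s)‖ ^ 2 * ‖ψ (A.piecewise s t)‖ ^ 2 : ℝ) : ℂ)]
  refine (Fintype.sum_equiv (swapOn A) _
    (fun q => ((‖ψ q.1‖ ^ 2 * ‖ψ q.2‖ ^ 2 : ℝ) : ℂ)) fun q => rfl).trans ?_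
  rw [Fintype.sum_prod_type, pow_two (∑ s, ‖ψ s‖ ^ 2), Finset.sum_mul_sum]
  push_cast
  rfl

theorem IsCosetState.sum_norm_sq {K : Submodule (ZMod 2) (E → ZMod 2)} {κ : ℝ}
    {ψ : Config E → ℂ} (h : IsCosetState K κ ψ) : ∑ s, ‖ψ s‖ ^ 2 = κ ^ 2 * Nat.card K := by
  obtain ⟨w, x, hw, h⟩ := h
  rw [← sum_indicator_add K x, Finset.mul_sum]
  refine Finset.sum_congr rfl fun s _ => ?_
  have h1 : (∏ e, w e (s e)) ^ 2 = 1 := by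
    rw [← Finset.prod_pow]; exact Finset.prod_eq_one fun e _ => hw e _
  have h2 : (K : Set (E → ZMod 2)).indicator (1 : (E → ZMod 2) → ℝ) (toChain s + x) ^ 2 =
      (K : Set (E → ZMod 2)).indicator (1 : (E → ZMod 2) → ℝ) (toChain s + x) := by
    by_cases hs : toChain s + x ∈ (K : Set (E → ZMod 2)) <;> simp [hs]
  rw [h, Complex.norm_real, Real.norm_eq_abs, sq_abs, mul_pow, mul_pow, h1, h2, mul_one]

theorem IsCosetState.partialTranspose_cube {K : Submodule (ZMod 2) (E → ZMod 2)} {κ : ℝ}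
    {ψ : Config E → ℂ} (h : IsCosetState K κ ψ) (A : Finset E) :
    partialTranspose A (pureState ψ) * partialTranspose A (pureState ψ) *
        partialTranspose A (pureState ψ) =
      (((κ ^ 2 * Nat.card (splitPart K A)) ^ 2 : ℝ) : ℂ) • partialTranspose A (pureState ψ) := by
  classical
  obtain ⟨w, x, hw, h⟩ := h
  let f : Config E → Config E → Prop := fun a b =>
    restrict A (toChain a) + (toChain b - restrict A (toChain b)) + x ∈ K
  let χ : Config E → ℝ := fun s => ∏ e, w e (s e)
  have hχ : ∀ s, χ s * χ s = 1 := fun s => by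
    rw [← pow_two, ← Finset.prod_pow]; exact Finset.prod_eq_one fun e _ => hw e _
  -- Exchanging A-parts only permutes the two local values at each edge, so local signs survive the
  -- partial transpose as a rank-one factor.
  have hχ' : ∀ s t, χ (A.piecewise t s) * χ (A.piecewise s t) = χ s * χ t := fun s t => by
    simp only [χ, ← Finset.prod_mul_distrib]
    refine Finset.prod_congr rfl fun e _ => ?_
    by_cases he : e ∈ A <;> simp [he, mul_comm]
  have hψ : ∀ a b, ψ (A.piecewise a b) =
      ((κ * χ (A.piecewise a b) * if f a b then 1 else 0 : ℝ) : ℂ) := fun a b => by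
    rw [h, toChain_piecewise, Set.indicator_apply]; rfl
  have hb : ∀ (p q : Prop) [Decidable p] [Decidable q],
      ((if p then 1 else 0 : ℝ) * if q then 1 else 0) = if p ∧ q then 1 else 0 :=
    fun p q _ _ => by rw [ite_zero_mul_ite_zero, mul_one]
  let R : Matrix (Config E) (Config E) ℝ := Matrix.of fun s t =>
    κ ^ 2 * (χ s * χ t) * if f t s ∧ f s t then 1 else 0
  have hRa : ∀ s t, R s t = κ ^ 2 * (χ s * χ t) * if f t s ∧ f s t then 1 else 0 :=
    fun _ _ => rfl
  have hR : partialTranspose A (pureState ψ) = R.map Complex.ofRealHom := by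
    ext s t
    simp only [partialTranspose, pureState, Matrix.vecMulVec_apply, Matrix.of_apply, Pi.star_apply,
      RCLike.star_def, Matrix.map_apply, R, hψ, Complex.conj_ofReal, Complex.ofRealHom_eq_coe]
    rw [← Complex.ofReal_mul, ← hχ', ← hb]
    congr 1
    ring
  have hL : ∀ t, ∑ u, (if toChain u - toChain t ∈ splitPart K A then 1 else 0 : ℝ) =
      Nat.card (splitPart K A) := fun t => by
    rw [← sum_indicator_add (splitPart K A) (-toChain t)]
    simp only [Set.indicator_apply, sub_eq_add_neg, SetLike.mem_coe, Pi.one_apply]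
  have hcube : R * R * R = ((κ ^ 2 * Nat.card (splitPart K A)) ^ 2) • R := by
    ext s t
    -- The signs at the intermediate u and v occur squared, and the support condition decouples.
    have h1 : ∀ v u, R s u * R u v * R v t = κ ^ 4 * R s t *
        ((if toChain v - toChain s ∈ splitPart K A then 1 else 0) *
          (if toChain u - toChain t ∈ splitPart K A then 1 else 0)) := by
      intro v u
      have h2 := swap_mem_iff K A x (toChain s) (toChain t) (toChain u) (toChain v)
      calc R s u * R u v * R v t
          = κ ^ 6 * (χ s * χ t) * (χ u * χ u) * (χ v * χ v) *
            ((if f u s ∧ f s u then 1 else 0) * ((if f v u ∧ f u v then 1 else 0) *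
              (if f t v ∧ f v t then 1 else 0))) := by simp only [hRa]; ring
        _ = κ ^ 6 * (χ s * χ t) * if (f t s ∧ f s t) ∧
              toChain u - toChain t ∈ splitPart K A ∧ toChain v - toChain s ∈ splitPart K A
              then 1 else 0 := by
            rw [hb, hb, hχ, hχ, mul_one, mul_one]
            congr 1
            exact if_congr h2 rfl rfl
        _ = _ := by
            rw [← hb (f t s ∧ f s t), ← hb (toChain u - toChain t ∈ _)]; simp only [hRa]; ring
    simp only [Matrix.mul_apply, Matrix.smul_apply, smul_eq_mul]
    simp only [Finset.sum_mul, h1]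
    simp only [← Finset.mul_sum, ← Finset.sum_mul, hL]
    ring
  rw [hR, ← Matrix.map_mul, ← Matrix.map_mul, hcube]
  ext s t
  simp

/-- Here μ = κ²|L| = |L|/|K| and tr H² = 1, so the trace norm is μ⁻¹ = |K|/|L|. -/
theorem IsCosetState.logNegativity_eq {K : Submodule (ZMod 2) (E → ZMod 2)} {κ : ℝ}
    {ψ : Config E → ℂ} (h : IsCosetState K κ ψ) (hκ : κ ^ 2 * Nat.card K = 1) (A : Finset E) :
    logNegativity A (pureState ψ) =
      Real.logb 2 (Nat.card K) - Real.logb 2 (Nat.card (splitPart K A)) := by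
  have hK : (0 : ℝ) < Nat.card K := by exact_mod_cast Nat.card_pos
  have hL : (0 : ℝ) < Nat.card (splitPart K A) := by exact_mod_cast Nat.card_pos
  have hκ' : κ ^ 2 = (Nat.card K : ℝ)⁻¹ := eq_inv_of_mul_eq_one_left hκ
  have hμ : 0 < κ ^ 2 * Nat.card (splitPart K A) := by rw [hκ']; positivity
  rw [logNegativity, trace_abs_of_cube_eq (partialTranspose_isHermitian A ψ) hμ
    (h.partialTranspose_cube A), trace_partialTranspose_sq, h.sum_norm_sq, hκ, one_pow,
    Complex.ofReal_one, mul_one, Complex.ofReal_re, hκ', mul_inv, inv_inv, ← div_eq_mul_inv,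
    Real.logb_div hK.ne' hL.ne']

end CosetStates

end ToricCode

namespace ToricCode

/-! ### Pauli operators acting on coset states. -/

section PauliOperators

set_option linter.unusedSectionVars false

variable {E : Type*} [Fintype E] [DecidableEq E]

theorem pauliZ_eq_diagonal (n : E → ℕ) :
    pauliZ n = Matrix.diagonal fun s : Config E =>
      ((∏ e, (-1 : ℝ) ^ (n e * (s e).val) : ℝ) : ℂ) := by
  have h : ∀ (k : ℕ) (a b : Fin 2), (sigmaZ ^ k) a b =
      if a = b then (((-1 : ℝ) ^ (k * a.val) : ℝ) : ℂ) else 0 := by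
    intro k a b
    have : sigmaZ = Matrix.diagonal fun a : Fin 2 => (-1 : ℂ) ^ a.val := by
      ext a b; fin_cases a <;> fin_cases b <;> simp [sigmaZ]
    rw [this, Matrix.diagonal_pow, Matrix.diagonal_apply]
    refine if_congr Iff.rfl ?_ rfl
    push_cast
    rw [Pi.pow_apply, mul_comm, pow_mul]
  ext s t
  simp only [pauliZ, tensorOp, Matrix.of_apply, h, Matrix.diagonal_apply]
  by_cases hst : s = t
  · subst hst; simp
  · obtain ⟨e, he⟩ := Function.ne_iff.1 hst
    rw [if_neg hst]
    exact Finset.prod_eq_zero (Finset.mem_univ e) (if_neg he)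

theorem prod_neg_one_pow (n : E → ℕ) (s : Config E) :
    ∏ e, (-1 : ℝ) ^ (n e * (s e).val) =
      if ∑ e, (n e : ZMod 2) * toChain s e = 0 then 1 else -1 := by
  have h : ((∑ e, n e * (s e).val : ℕ) : ZMod 2) = ∑ e, (n e : ZMod 2) * toChain s e := by
    push_cast
    exact Finset.sum_congr rfl fun e _ => congrArg _ (ZMod.natCast_zmod_val (n := 2) (toChain s e))
  rw [Finset.prod_pow_eq_pow_sum, ← h]
  simp only [ZMod.natCast_eq_zero_iff_even]
  split_ifs with h2
  · exact h2.neg_one_pow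
  · exact (Nat.not_even_iff_odd.1 h2).neg_one_pow

theorem projPlus_pauliZ (n : E → ℕ) :
    projPlus (pauliZ n) = Matrix.diagonal fun s : Config E =>
      if ∑ e, (n e : ZMod 2) * toChain s e = 0 then 1 else 0 := by
  ext s t
  simp only [projPlus, pauliZ_eq_diagonal, prod_neg_one_pow, Matrix.smul_apply, Matrix.add_apply,
    Matrix.one_apply, Matrix.diagonal_apply, smul_eq_mul]
  split_ifs <;> norm_num

theorem noncommProd_diagonal {ι n α : Type*} [Fintype n] [DecidableEq n] [CommSemiring α]
    (s : Finset ι) {f : ι → Matrix n n α} {g : ι → n → α}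
    (h : ∀ i, f i = Matrix.diagonal (g i)) (comm) :
    s.noncommProd f comm = Matrix.diagonal (∏ i ∈ s, g i) := by
  induction s using Finset.cons_induction with
  | empty => simp
  | cons a s ha ih =>
    rw [Finset.noncommProd_cons, ih, Finset.prod_cons, h, Matrix.diagonal_mul_diagonal']
    rfl

theorem IsCosetState.normalize {K : Submodule (ZMod 2) (E → ZMod 2)} {κ : ℝ}
    {ψ : Config E → ℂ} (h : IsCosetState K κ ψ) (hκ : κ ≠ 0) :
    ∃ κ' : ℝ, κ' ^ 2 * Nat.card K = 1 ∧ IsCosetState K κ' (ToricCode.normalize ψ) := by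
  have hK : (0 : ℝ) < Nat.card K := by exact_mod_cast Nat.card_pos
  have hpos : 0 < κ ^ 2 * Nat.card K := by positivity
  refine ⟨1 / √(κ ^ 2 * Nat.card K) * κ, ?_, ?_⟩
  · rw [mul_pow, div_pow, Real.sq_sqrt hpos.le]
    field_simp
  · have hs := h.sum_norm_sq
    obtain ⟨w, x, hw, h⟩ := h
    refine ⟨w, x, hw, fun s => ?_⟩
    rw [ToricCode.normalize, hs, Pi.smul_apply, h, smul_eq_mul, ← Complex.ofReal_mul]
    congr 1
    ring

theorem IsCosetState.pauliZ {K : Submodule (ZMod 2) (E → ZMod 2)} {κ : ℝ}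
    {ψ : Config E → ℂ} (h : IsCosetState K κ ψ) (n : E → ℕ) :
    IsCosetState K κ ((pauliZ n).mulVec ψ) := by
  obtain ⟨w, x, hw, h⟩ := h
  refine ⟨fun e a => (-1) ^ (n e * a.val) * w e a, x, fun e a => ?_, fun s => ?_⟩
  · rw [mul_pow, hw, ← pow_mul, mul_comm _ 2, pow_mul]; simp
  · rw [pauliZ_eq_diagonal, Matrix.mulVec_diagonal, h, ← Complex.ofReal_mul,
      Finset.prod_mul_distrib]
    congr 1
    ring

theorem loopX_mulVec (ℓ : Finset E) (ψ : Config E → ℂ) (s : Config E) :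
    (TorusLattice.loopX ℓ).mulVec ψ s = ψ fun e => s e + if e ∈ ℓ then 1 else 0 := by
  have h : ∀ (e : E) (a b : Fin 2), (sigmaX ^ (if e ∈ ℓ then 1 else 0)) a b =
      if b = a + (if e ∈ ℓ then 1 else 0) then 1 else 0 := by
    intro e a b
    split_ifs <;> fin_cases a <;> fin_cases b <;> simp_all [sigmaX]
  simp only [Matrix.mulVec, dotProduct, TorusLattice.loopX, pauliX, tensorOp, Matrix.of_apply, h,
    Finset.prod_boole, Finset.mem_univ, true_imp_iff, ite_mul, one_mul, zero_mul]
  rw [Finset.sum_eq_single fun e => s e + if e ∈ ℓ then 1 else 0]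
  · simp
  · intro t _ ht
    exact if_neg fun h' => ht (funext fun e => h' e)
  · simp

theorem IsCosetState.loopX {K : Submodule (ZMod 2) (E → ZMod 2)} {κ : ℝ}
    {ψ : Config E → ℂ} (h : IsCosetState K κ ψ) (ℓ : Finset E) :
    IsCosetState K κ ((TorusLattice.loopX ℓ).mulVec ψ) := by
  obtain ⟨w, x, hw, h⟩ := h
  -- The flip moves the coset by the chain of ℓ, and the local signs are read at the flipped values.
  refine ⟨fun e a => w e (a + if e ∈ ℓ then 1 else 0),
    toChain (fun e => if e ∈ ℓ then 1 else 0) + x, fun e a => hw e _, fun s => ?_⟩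
  rw [loopX_mulVec, h, ← add_assoc]
  rfl

end PauliOperators

/-! ### Ground states as coset states. -/

namespace TorusLattice

variable {V E F D : Type*} [Fintype V] [DecidableEq V] [Fintype E] [DecidableEq E]
  [Fintype F] [DecidableEq F] [Fintype D] [DecidableEq D]

set_option linter.unusedSectionVars false

/-- The matrix over `𝔽₂` whose rows are the boundaries of the faces and the loop `ℓ`. -/
def checkMatrix (T : TorusLattice V E F D) (ℓ : Finset E) : Matrix (Option F) E (ZMod 2) :=
  fun o e => o.elim (if e ∈ ℓ then 1 else 0)
    fun p => (Finset.card {d : D | T.edge d = e ∧ T.face d = p} : ZMod 2)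

/-- The configurations of trivial flux through all faces and along `ℓ`. -/
def fluxFree (T : TorusLattice V E F D) (ℓ : Finset E) : Submodule (ZMod 2) (E → ZMod 2) :=
  LinearMap.ker (T.checkMatrix ℓ).mulVecLin

theorem mem_fluxFree (T : TorusLattice V E F D) (ℓ : Finset E) (s : E → ZMod 2) :
    s ∈ T.fluxFree ℓ ↔ (∑ e, (if e ∈ ℓ then 1 else 0) * s e = 0) ∧
      ∀ p, ∑ e, (Finset.card {d : D | T.edge d = e ∧ T.face d = p} : ZMod 2) * s e = 0 := by
  simp only [fluxFree, LinearMap.mem_ker, Matrix.mulVecLin_apply, funext_iff, Option.forall,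
    Matrix.mulVec, dotProduct, checkMatrix, Option.elim, Pi.zero_apply]

/-- Every factor is diagonal, the 0/1 indicator of one parity check, so the product is the indicator
of all checks together. -/
theorem plaquetteProj_mul_projPlus (T : TorusLattice V E F D) (ℓ : Finset E) :
    T.plaquetteProj * projPlus (loopZ ℓ) = Matrix.diagonal fun s : Config E =>
      (((T.fluxFree ℓ : Set (E → ZMod 2)).indicator 1 (toChain s) : ℝ) : ℂ) := by
  classical
  have h : T.plaquetteProj = Matrix.diagonal (∏ p : F, fun s : Config E =>
      if ∑ e, (Finset.card {d : D | T.edge d = e ∧ T.face d = p} : ZMod 2) * toChain s e = 0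
        then (1 : ℂ) else 0) := by
    exact noncommProd_diagonal _ (fun p => projPlus_pauliZ _) _
  rw [h, loopZ, projPlus_pauliZ, Matrix.diagonal_mul_diagonal]
  congr 1
  funext s
  rw [Finset.prod_apply, Finset.prod_boole, Set.indicator_apply, SetLike.mem_coe, mem_fluxFree,
    ite_zero_mul_ite_zero, mul_one]
  simp only [Finset.mem_univ, true_imp_iff, Pi.one_apply, and_comm, Nat.cast_ite, Nat.cast_one,
    Nat.cast_zero]
  split_ifs <;> simp

theorem exists_isCosetState (T : TorusLattice V E F D) (W : T.Loops) (i : Flux) :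
    ∃ κ : ℝ, κ ^ 2 * Nat.card (T.fluxFree W.z₁) = 1 ∧
      IsCosetState (T.fluxFree W.z₁) κ (T.fluxState W i) := by
  have h : IsCosetState (T.fluxFree W.z₁) (∏ _e : E, (1 / √2 : ℝ))
      ((T.plaquetteProj * projPlus (loopZ W.z₁)).mulVec plusState) := by
    refine ⟨fun _ _ => 1, 0, by simp, fun s => ?_⟩
    rw [plaquetteProj_mul_projPlus, Matrix.mulVec_diagonal, plusState, ← Complex.ofReal_prod,
      ← Complex.ofReal_mul, Finset.prod_const_one, mul_one, add_zero, mul_comm]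
  obtain ⟨κ, hκ, hI⟩ := h.normalize (Finset.prod_ne_zero_iff.2 fun _ _ => by positivity)
  refine ⟨κ, hκ, ?_⟩
  cases i with
  | I => exact hI
  | e => exact hI.loopX _
  | m => exact hI.pauliZ _
  | em =>
    rw [fluxState, ← Matrix.mulVec_mulVec]
    exact (hI.pauliZ _).loopX _

end TorusLattice

end ToricCode

namespace ToricCode

/-! ### Relations among the checks, and boundary plaquettes. -/

namespace TorusLattice

variable {V E F D : Type*} [Fintype V] [DecidableEq V] [Fintype E] [DecidableEq E]
  [Fintype F] [DecidableEq F] [Fintype D] [DecidableEq D]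

set_option linter.unusedSectionVars false

theorem edge_rev (T : TorusLattice V E F D) (d : D) : T.edge (T.rev d) = T.edge d :=
  ((T.edge_eq_iff d (T.rev d)).2 (Or.inr rfl)).symm

/-- Around its face, the reverse of `rot d` is followed by d itself; both edges of a corner thus
border the face of that corner. -/
theorem face_rev_rot (T : TorusLattice V E F D) (d : D) : T.face (T.rev (T.rot d)) = T.face d := by
  refine (T.face_eq_iff _ _).2 ⟨1, ?_⟩
  simp [T.rev_rev]

/-- The boundary of a chain of faces, at the edge of `d`. -/
theorem sum_mul_card (T : TorusLattice V E F D) (g : F → ZMod 2) (d : D) :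
    ∑ p, g p * (Finset.card {d' : D | T.edge d' = T.edge d ∧ T.face d' = p} : ZMod 2) =
      g (T.face d) + g (T.face (T.rev d)) := by
  have h : ∀ p, g p * (Finset.card {d' : D | T.edge d' = T.edge d ∧ T.face d' = p} : ZMod 2) =
      ∑ d' with T.edge d' = T.edge d, if T.face d' = p then g p else 0 := by
    intro p
    rw [← Finset.sum_filter, Finset.filter_filter, Finset.sum_const, nsmul_eq_mul, mul_comm]
  have hd : ({d' : D | T.edge d' = T.edge d} : Finset D) = {d, T.rev d} := by
    ext d'
    simp only [Finset.mem_filter, Finset.mem_univ, true_and, Finset.mem_insert,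
      Finset.mem_singleton]
    rw [eq_comm, T.edge_eq_iff]
  simp only [h]
  rw [Finset.sum_comm, hd, Finset.sum_pair (T.rev_ne d).symm]
  simp

theorem vecMul_checkMatrix (T : TorusLattice V E F D) (ℓ : Finset E) (P : Option F → ZMod 2)
    (d : D) : (T.checkMatrix ℓ).vecMul P (T.edge d) =
      P none * (if T.edge d ∈ ℓ then 1 else 0) +
        (P (some (T.face d)) + P (some (T.face (T.rev d)))) := by
  rw [Matrix.vecMul, dotProduct, Fintype.sum_option]
  exact congrArg _ (T.sum_mul_card (fun p => P (some p)) d)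

/-- The region `A` passes along the face `p`. -/
def Touches (T : TorusLattice V E F D) (A : Finset E) (p : F) : Prop :=
  ∃ d, T.face d = p ∧ T.edge d ∈ A

/-- Both `rev` and `rot` move to a face across an edge, and together they act transitively on darts.
-/
theorem eq_of_forall_eq (T : TorusLattice V E F D) {α : Type*} {g : F → α}
    (h : ∀ d, g (T.face d) = g (T.face (T.rev d))) (p q : F) : g p = g q := by
  obtain ⟨d, rfl⟩ := T.face_surjective p
  obtain ⟨d', rfl⟩ := T.face_surjective q
  have key : ∀ σ ∈ Subgroup.closure {T.rot, T.rev}, ∀ d, g (T.face (σ d)) = g (T.face d) := by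
    intro σ hσ
    induction hσ using Subgroup.closure_induction with
    | mem σ hσ =>
      intro d
      rcases hσ with rfl | rfl
      · rw [h, face_rev_rot]
      · exact (h d).symm
    | one => exact fun d => rfl
    | mul σ τ _ _ h1 h2 => exact fun d => (h1 (τ d)).trans (h2 d)
    | inv σ _ h1 => exact fun d =>
      (h1 (σ⁻¹ d)).symm.trans (congrArg (g ∘ T.face) (σ.apply_symm_apply d))
  obtain ⟨σ, rfl⟩ := T.connected.exists_smul_eq d d'
  exact (key σ.1 σ.2 d).symm

/-- Consecutive edges of A around a vertex border a common face, and g does not jump across either;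
a walk in A carries the value along. -/
theorem eq_of_touches (T : TorusLattice V E F D) {A : Finset E}
    (hA : (T.neighbourGraph.induce (A : Set E)).Connected) {α : Type*} {g : F → α}
    (h : ∀ d, T.edge d ∈ A → g (T.face d) = g (T.face (T.rev d))) {p q : F}
    (hp : T.Touches A p) (hq : T.Touches A q) : g p = g q := by
  obtain ⟨d, rfl, hd⟩ := hp
  obtain ⟨d', rfl, hd'⟩ := hq
  have same : ∀ d d', T.edge d ∈ A → T.edge d = T.edge d' → g (T.face d) = g (T.face d') := by
    intro d d' hd he
    rcases (T.edge_eq_iff d d').1 he with rfl | rfl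
    · rfl
    · exact h d hd
  have step : ∀ d, T.edge d ∈ A → T.edge (T.rot d) ∈ A →
      g (T.face d) = g (T.face (T.rot d)) := by
    intro d _ h2
    rw [h _ h2, face_rev_rot]
  obtain ⟨w⟩ := hA.preconnected ⟨T.edge d, hd⟩ ⟨T.edge d', hd'⟩
  have key : ∀ {a b : (A : Set E)}, (T.neighbourGraph.induce (A : Set E)).Walk a b →
      ∀ d d', T.edge d = a → T.edge d' = b → g (T.face d) = g (T.face d') := by
    intro a b w
    induction w with
    | @nil a =>
      intro d d' h1 h2
      exact same d d' (h1 ▸ a.2) (h1.trans h2.symm)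
    | @cons a b c hab _ ih =>
      intro d d' h1 h2
      obtain ⟨b', hb'⟩ := T.edge_surjective b
      rw [← ih b' d' hb' h2]
      have ha : T.edge d ∈ A := h1 ▸ a.2
      have hb : T.edge b' ∈ A := hb' ▸ b.2
      rw [SimpleGraph.comap_adj, neighbourGraph, SimpleGraph.fromRel_adj] at hab
      rcases hab.2 with ⟨c, hc, hc'⟩ | ⟨c, hc, hc'⟩
      · have h3 : T.edge c = T.edge d := hc.trans h1.symm
        have h4 : T.edge (T.rot c) = T.edge b' := hc'.trans hb'.symm
        rw [← same c d (h3 ▸ ha) h3, ← same _ b' (h4 ▸ hb) h4]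
        exact step c (h3 ▸ ha) (h4 ▸ hb)
      · have h3 : T.edge c = T.edge b' := hc.trans hb'.symm
        have h4 : T.edge (T.rot c) = T.edge d := hc'.trans h1.symm
        rw [← same c b' (h3 ▸ hb) h3, ← same _ d (h4 ▸ ha) h4]
        exact (step c (h3 ▸ hb) (h4 ▸ ha)).symm
  exact key w d d' rfl rfl

/-- Pairing with the dual cycle `x₂` kills every face boundary and gives 1 on `z₁`, so it isolates
the coefficient of the loop. -/
theorem sum_vecMul_checkMatrix (T : TorusLattice V E F D) (W : T.Loops) (P : Option F → ZMod 2) :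
    ∑ e ∈ W.x₂, (T.checkMatrix W.z₁).vecMul P e = P none := by
  have h1 : ∑ e ∈ W.x₂, (if e ∈ W.z₁ then 1 else 0 : ZMod 2) = 1 := by
    rw [Finset.sum_boole, Finset.filter_mem_eq_inter]
    exact ZMod.natCast_eq_one_iff_odd.2 W.odd_x₂_z₁
  have h2 : ∀ p, ∑ e ∈ W.x₂, (Finset.card {d : D | T.edge d = e ∧ T.face d = p} : ZMod 2) = 0 := by
    intro p
    rw [← Nat.cast_sum, ZMod.natCast_eq_zero_iff_even]
    convert W.x₂_closed p
    rw [Finset.card_eq_sum_card_fiberwise (f := T.edge) (t := W.x₂)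
      fun d hd => (Finset.mem_filter.1 hd).2.2]
    refine Finset.sum_congr rfl fun e he => ?_
    congr 1
    ext d
    simp only [Finset.mem_filter, Finset.mem_univ, true_and]
    constructor
    · rintro ⟨rfl, h⟩; exact ⟨⟨h, he⟩, rfl⟩
    · rintro ⟨⟨h, _⟩, h'⟩; exact ⟨h', h⟩
  simp only [Matrix.vecMul, dotProduct]
  rw [Finset.sum_comm]
  simp only [← Finset.mul_sum]
  rw [Fintype.sum_option]
  simp only [checkMatrix, Option.elim, h1, h2, mul_zero, Finset.sum_const_zero, add_zero, mul_one]

/-- A relation cannot involve the loop, by pairing with `x₂`; its face coefficients agree across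
every edge and are therefore constant. -/
theorem card_vecMul_eq_zero (T : TorusLattice V E F D) (W : T.Loops) :
    Nat.card {P : Option F → ZMod 2 // (T.checkMatrix W.z₁).vecMul P = 0} = 2 := by
  obtain ⟨d₀⟩ := T.nonempty
  have hn : ∀ P : Option F → ZMod 2, (T.checkMatrix W.z₁).vecMul P = 0 → P none = 0 := by
    intro P hP
    rw [← T.sum_vecMul_checkMatrix W P, hP]
    simp
  let φ : {P : Option F → ZMod 2 // (T.checkMatrix W.z₁).vecMul P = 0} ≃ ZMod 2 :=
    { toFun := fun P => P.1 (some (T.face d₀))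
      invFun := fun c => ⟨fun o => o.elim 0 fun _ => c, by
        ext e
        obtain ⟨d, rfl⟩ := T.edge_surjective e
        rw [vecMul_checkMatrix]
        simp [CharTwo.add_self_eq_zero]⟩
      left_inv := by
        rintro ⟨P, hP⟩
        ext o
        cases o with
        | none => exact (hn P hP).symm
        | some p =>
          refine T.eq_of_forall_eq (g := fun p => P (some p)) (fun d => ?_) _ p
          have := congrFun hP (T.edge d)
          rw [vecMul_checkMatrix, hn P hP, zero_mul, zero_add] at this
          exact CharTwo.add_eq_zero.1 this
      right_inv := fun c => rfl }
  rw [Nat.card_congr φ, Nat.card_zmod]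

theorem card_restrict_vecMul_eq_zero (T : TorusLattice V E F D) {ℓ A : Finset E}
    (hA : (T.neighbourGraph.induce (A : Set E)).Connected) (hℓ : T.DeformsInto ℓ Aᶜ) :
    Nat.card {P : Option F → ZMod 2 // restrict A ((T.checkMatrix ℓ).vecMul P) = 0} =
      4 * 2 ^ Nat.card {p // ¬ T.Touches A p} := by
  classical
  obtain ⟨Q, hQ⟩ := hℓ
  let q : F → ZMod 2 := fun p => if p ∈ Q then 1 else 0
  have hq : ∀ d, T.edge d ∈ A →
      (if T.edge d ∈ ℓ then 1 else 0) + (q (T.face d) + q (T.face (T.rev d))) = 0 := by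
    intro d hd
    have h1 := (ZMod.natCast_eq_zero_iff_even).2 (hQ (T.edge d) (by simpa using hd))
    have hd' : ({d' : D | T.edge d' = T.edge d ∧ T.face d' ∈ Q} : Finset D) =
        ({d, T.rev d} : Finset D).filter fun d' => T.face d' ∈ Q := by
      ext d'
      simp only [Finset.mem_filter, Finset.mem_univ, true_and, Finset.mem_insert,
        Finset.mem_singleton]
      rw [eq_comm, T.edge_eq_iff]
    rw [Nat.cast_add, hd', Finset.card_filter, Finset.sum_pair (T.rev_ne d).symm] at h1
    push_cast at h1
    exact h1
  -- On A the loop equals the boundary of Q, so subtracting `P none * q` absorbs it: a relation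
  -- means that the corrected face coefficients do not jump across A.
  have hmem : ∀ P : Option F → ZMod 2, restrict A ((T.checkMatrix ℓ).vecMul P) = 0 ↔
      ∀ d, T.edge d ∈ A → P (some (T.face d)) - P none * q (T.face d) =
        P (some (T.face (T.rev d))) - P none * q (T.face (T.rev d)) := by
    intro P
    have h₀ : ∀ d, T.edge d ∈ A → ((T.checkMatrix ℓ).vecMul P (T.edge d) = 0 ↔
        P (some (T.face d)) - P none * q (T.face d) =
        P (some (T.face (T.rev d))) - P none * q (T.face (T.rev d))) := by
      intro d hd
      rw [vecMul_checkMatrix, eq_neg_of_add_eq_zero_left (hq d hd), ← sub_eq_zero (b := _ - _),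
        CharTwo.neg_eq, CharTwo.sub_eq_add, CharTwo.sub_eq_add, CharTwo.sub_eq_add]
      constructor <;> intro h <;> rw [← h] <;> ring
    rw [funext_iff]
    constructor
    · intro h d hd
      have := h (T.edge d)
      rw [restrict_apply, if_pos hd] at this
      exact (h₀ d hd).1 this
    · intro h e
      obtain ⟨d, rfl⟩ := T.edge_surjective e
      rw [restrict_apply]
      split_ifs with hd
      · exact (h₀ d hd).2 (h d hd)
      · rfl
  obtain ⟨e₀, he₀⟩ := hA.nonempty
  obtain ⟨d₀, rfl⟩ := T.edge_surjective e₀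
  -- The coordinates are the loop coefficient, the common corrected value on touched faces, and free
  -- values on untouched ones. The first two give the factor 4.
  let φ : {P : Option F → ZMod 2 // restrict A ((T.checkMatrix ℓ).vecMul P) = 0} ≃
      (ZMod 2 × ZMod 2) × ({p // ¬ T.Touches A p} → ZMod 2) :=
    { toFun := fun P => ((P.1 none, P.1 (some (T.face d₀)) - P.1 none * q (T.face d₀)),
        fun p => P.1 (some p.1) - P.1 none * q p.1)
      invFun := fun x => ⟨fun o => o.elim x.1.1 fun p => x.1.1 * q p +
        if h : T.Touches A p then x.1.2 else x.2 ⟨p, h⟩, by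
          rw [hmem]
          intro d hd
          have h1 : T.Touches A (T.face d) := ⟨d, rfl, hd⟩
          have h2 : T.Touches A (T.face (T.rev d)) := ⟨T.rev d, rfl, by rwa [edge_rev]⟩
          simp [h1, h2]⟩
      left_inv := by
        rintro ⟨P, hP⟩
        ext o
        cases o with
        | none => rfl
        | some p =>
          change P none * q p + _ = P (some p)
          split_ifs with h
          · change P none * q p + (P (some (T.face d₀)) - P none * q (T.face d₀)) = P (some p)
            rw [← T.eq_of_touches hA (g := fun p => P (some p) - P none * q p) ((hmem P).1 hP) h
              ⟨d₀, rfl, he₀⟩]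
            ring
          · ring
      right_inv := by
        rintro ⟨⟨a, b⟩, f⟩
        have h0 : T.Touches A (T.face d₀) := ⟨d₀, rfl, he₀⟩
        refine Prod.ext (Prod.ext rfl ?_) (funext fun p => ?_)
        · simp [h0]
        · simp [p.2] }
  rw [Nat.card_congr φ, Nat.card_prod, Nat.card_prod, Nat.card_fun, Nat.card_zmod]

theorem card_fluxFree_mul (T : TorusLattice V E F D) (W : T.Loops) :
    Nat.card (T.fluxFree W.z₁) * 2 ^ (Fintype.card F + 1) = 2 * 2 ^ Fintype.card E := by
  have h := card_ker_mul_two_pow (T.checkMatrix W.z₁)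
  rw [T.card_vecMul_eq_zero W, Fintype.card_option] at h
  exact h

/-- L is the kernel of the checks cut down to A stacked on those cut down to its complement. The two
blocks of columns are disjoint, so the relations of the stack are pairs of relations. -/
theorem card_splitPart_mul (T : TorusLattice V E F D) (ℓ A : Finset E) :
    Nat.card (splitPart (T.fluxFree ℓ) A) * 2 ^ (2 * (Fintype.card F + 1)) =
      Nat.card {P : Option F → ZMod 2 // restrict A ((T.checkMatrix ℓ).vecMul P) = 0} *
      Nat.card {P : Option F → ZMod 2 // restrict Aᶜ ((T.checkMatrix ℓ).vecMul P) = 0} *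
        2 ^ Fintype.card E := by
  let N : Finset E → Matrix (Option F) E (ZMod 2) := fun A o => restrict A (T.checkMatrix ℓ o)
  have h1 : ∀ A s, (N A).mulVec s = (T.checkMatrix ℓ).mulVec (restrict A s) := by
    intro A s
    ext o
    refine Finset.sum_congr rfl fun e _ => ?_
    simp only [N, restrict_apply, ite_mul, mul_ite, zero_mul, mul_zero]
  have h2 : ∀ A P, (N A).vecMul P = restrict A ((T.checkMatrix ℓ).vecMul P) := by
    intro A P
    ext e
    simp only [Matrix.vecMul, dotProduct, N, restrict_apply]
    split_ifs <;> simp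
  have h3 : ∀ u v : E → ZMod 2, restrict A u + restrict Aᶜ v = 0 ↔
      restrict A u = 0 ∧ restrict Aᶜ v = 0 := by
    intro u v
    refine ⟨fun h => ⟨?_, ?_⟩, fun h => by rw [h.1, h.2, add_zero]⟩ <;> ext e <;>
      have h' := congrFun h e <;> by_cases he : e ∈ A <;> simp_all [restrict_apply]
  have h := card_ker_mul_two_pow (Matrix.fromRows (N A) (N Aᶜ))
  rw [Fintype.card_sum, Fintype.card_option, ← two_mul] at h
  have h4 : Nat.card (splitPart (T.fluxFree ℓ) A) =
      Nat.card {s : E → ZMod 2 // (Matrix.fromRows (N A) (N Aᶜ)).mulVec s = 0} := by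
    refine Nat.card_congr (Equiv.subtypeEquiv (Equiv.refl (E → ZMod 2)) fun s => ?_)
    rw [Equiv.refl_apply, Matrix.fromRows_mulVec, h1, h1]
    simp [splitPart, fluxFree, funext_iff]
  have h5 : Nat.card ({P : Option F → ZMod 2 // restrict A ((T.checkMatrix ℓ).vecMul P) = 0} ×
        {P : Option F → ZMod 2 // restrict Aᶜ ((T.checkMatrix ℓ).vecMul P) = 0}) =
      Nat.card {P : Option F ⊕ Option F → ZMod 2 //
        (Matrix.fromRows (N A) (N Aᶜ)).vecMul P = 0} := by
    refine Nat.card_congr (Equiv.subtypeProdEquivProd.symm.trans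
      (Equiv.subtypeEquiv (Equiv.sumArrowEquivProdArrow _ _ _).symm fun P => ?_))
    rw [Matrix.vecMul_fromRows, h2, h2, h3]
    rfl
  rw [← Nat.card_prod, h4, h5, h]

/-- Going around a face from an edge in A without passing a crossed corner, one never leaves A. -/
theorem exists_isCrossed_iff (T : TorusLattice V E F D) (A : Finset E) (p : F) :
    (∃ d, T.IsCrossed A d ∧ T.face d = p) ↔ T.Touches A p ∧ T.Touches Aᶜ p := by
  constructor
  · rintro ⟨d, hd, rfl⟩
    have h1 : T.edge (T.rev (T.rot d)) = T.edge (T.rot d) := T.edge_rev _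
    by_cases h : T.edge d ∈ A
    · exact ⟨⟨d, rfl, h⟩, T.rev (T.rot d), T.face_rev_rot d, by
        rw [h1, Finset.mem_compl]; exact fun h2 => hd ⟨fun _ => h2, fun _ => h⟩⟩
    · refine ⟨⟨T.rev (T.rot d), T.face_rev_rot d, ?_⟩, d, rfl, Finset.mem_compl.2 h⟩
      rw [h1]
      by_contra h2
      exact hd ⟨fun h3 => (h h3).elim, fun h3 => (h2 h3).elim⟩
  · rintro ⟨⟨d, rfl, hd⟩, d', hd', hA⟩
    by_contra! hno
    obtain ⟨n, -, hn⟩ := ((T.face_eq_iff d d').1 hd'.symm).exists_pow_eq'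
    have key : ∀ n : ℕ, T.edge (((T.rot⁻¹ * T.rev) ^ n) d) ∈ A := by
      intro n
      induction n with
      | zero => exact hd
      | succ n ih =>
        set a := ((T.rot⁻¹ * T.rev) ^ n) d with ha
        have hs : ((T.rot⁻¹ * T.rev) ^ (n + 1)) d = T.rot⁻¹ (T.rev a) := by
          rw [pow_succ', Equiv.Perm.mul_apply]; rfl
        have hf : T.face (T.rot⁻¹ (T.rev a)) = T.face d := by
          rw [← hs]
          exact ((T.face_eq_iff _ _).2 ⟨((n + 1 : ℕ) : ℤ), by rw [zpow_natCast]⟩).symm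
        rw [hs]
        by_contra hc
        refine hno _ (fun hiff => hc (hiff.2 ?_)) hf
        rwa [show T.rot (T.rot⁻¹ (T.rev a)) = T.rev a from T.rot.apply_symm_apply _, edge_rev]
    rw [← hn] at hA
    exact Finset.mem_compl.1 hA (key n)

/-- Crossed corners of one face are joined, so no face is counted for both components. -/
theorem numPlaquettes_add (T : TorusLattice V E F D) (A : Finset E)
    (Γ₁ Γ₂ : (T.boundaryGraph A).ConnectedComponent) (hne : Γ₁ ≠ Γ₂)
    (hall : ∀ Γ, Γ = Γ₁ ∨ Γ = Γ₂) :
    T.numPlaquettes A Γ₁ + T.numPlaquettes A Γ₂ =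
      Nat.card {p // T.Touches A p ∧ T.Touches Aᶜ p} := by
  have hm : Nat.card {p // T.Touches A p ∧ T.Touches Aᶜ p} =
      Set.ncard {p | T.Touches A p ∧ T.Touches Aᶜ p} :=
    Nat.card_congr (Equiv.subtypeEquivRight fun p => Iff.rfl)
  rw [hm, numPlaquettes, numPlaquettes, ← Set.ncard_union_eq _ (Set.toFinite _) (Set.toFinite _)]
  · refine congrArg Set.ncard (Set.ext fun p => ?_)
    rw [Set.mem_ofPred_eq, ← exists_isCrossed_iff]
    constructor
    · rintro (⟨d, -, hd⟩ | ⟨d, -, hd⟩) <;> exact ⟨d.1, d.2, hd⟩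
    · rintro ⟨d, hd, hp⟩
      rcases hall ((T.boundaryGraph A).connectedComponentMk ⟨d, hd⟩) with h | h
      · exact Or.inl ⟨⟨d, hd⟩, h, hp⟩
      · exact Or.inr ⟨⟨d, hd⟩, h, hp⟩
  · rw [Set.disjoint_left]
    rintro p ⟨d, hd, hp⟩ ⟨d', hd', hp'⟩
    rw [SimpleGraph.ConnectedComponent.mem_supp_iff] at hd hd'
    refine hne ?_
    rw [← hd, ← hd']
    by_cases h : d = d'
    · rw [h]
    · refine SimpleGraph.ConnectedComponent.sound (SimpleGraph.Adj.reachable ?_)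
      rw [boundaryGraph, SimpleGraph.fromRel_adj]
      exact ⟨h, Or.inl (Or.inr (hp.trans hp'.symm))⟩

theorem card_faces (T : TorusLattice V E F D) (A : Finset E) :
    Fintype.card F = Nat.card {p // ¬ T.Touches A p} + Nat.card {p // ¬ T.Touches Aᶜ p} +
      Nat.card {p // T.Touches A p ∧ T.Touches Aᶜ p} := by
  classical
  have h : ∀ p, T.Touches A p ∨ T.Touches Aᶜ p := by
    intro p
    obtain ⟨d, hd⟩ := T.face_surjective p
    by_cases he : T.edge d ∈ A
    · exact Or.inl ⟨d, hd, he⟩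
    · exact Or.inr ⟨d, hd, Finset.mem_compl.2 he⟩
  simp only [Nat.card_eq_fintype_card, Fintype.card_subtype, Finset.card_filter]
  rw [← Finset.card_univ, Finset.card_eq_sum_ones, ← Finset.sum_add_distrib,
    ← Finset.sum_add_distrib]
  refine Finset.sum_congr rfl fun p _ => ?_
  rcases h p with h | h <;> by_cases h' : T.Touches A p <;> by_cases h'' : T.Touches Aᶜ p <;>
    simp_all

end TorusLattice

end ToricCode

/-- `A | B` is a bipartition of the edges of a lattice on the torus into two connected regions that
are non-contractible in direction `1`, and `Γ₁`, `Γ₂` are the two boundaries that they share. -/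
theorem mainTheorem6 {V E F D : Type*} [Fintype V] [DecidableEq V] [Fintype E] [DecidableEq E]
    [Fintype F] [DecidableEq F] [Fintype D] [DecidableEq D]
    (T : ToricCode.TorusLattice V E F D) (W : T.Loops)
    (A B : Finset E) (hAB : IsCompl A B)
    (hA : T.IsNonContractibleRegion W.z₁ A) (hB : T.IsNonContractibleRegion W.z₁ B)
    (Γ₁ Γ₂ : (T.boundaryGraph A).ConnectedComponent) (hne : Γ₁ ≠ Γ₂)
    (hall : ∀ Γ, Γ = Γ₁ ∨ Γ = Γ₂) (i : ToricCode.Flux) :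
    ToricCode.logNegativity A (ToricCode.pureState (T.fluxState W i)) =
      ((T.numPlaquettes A Γ₁ : ℝ) - 1) + ((T.numPlaquettes A Γ₂ : ℝ) - 1) := by
  obtain rfl : Aᶜ = B := hAB.compl_eq
  obtain ⟨κ, hκ, hψ⟩ := T.exists_isCosetState W i
  rw [hψ.logNegativity_eq hκ]
  have hK := T.card_fluxFree_mul W
  have hL := T.card_splitPart_mul W.z₁ A
  -- Each region's count uses its own connectedness and the loop deformed into the other region.
  rw [T.card_restrict_vecMul_eq_zero hA.connected hB.loop,
    T.card_restrict_vecMul_eq_zero hB.connected (by rw [compl_compl]; exact hA.loop)] at hL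
  have hF := T.card_faces A
  rw [← T.numPlaquettes_add A Γ₁ Γ₂ hne hall] at hF
  generalize Nat.card {p // ¬ T.Touches A p} = a at hL hF
  generalize Nat.card {p // ¬ T.Touches Aᶜ p} = b at hL hF
  have hlog : ∀ {k m n : ℕ}, 0 < k → k * 2 ^ m = 2 ^ n → Real.logb 2 k = n - m := by
    intro k m n hk h
    have h' : (k : ℝ) * 2 ^ m = 2 ^ n := by exact_mod_cast h
    have h2 := congrArg (Real.logb 2) h'
    rw [Real.logb_mul (by positivity) (by positivity), Real.logb_pow, Real.logb_pow,
      Real.logb_self_eq_one one_lt_two] at h2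
    linarith
  -- The 1 is the single relation on all edges; the 4 is two extra dimensions of relations for each
  -- region.
  rw [hlog (n := 1 + Fintype.card E) Nat.card_pos (hK.trans (by ring)),
    hlog (n := 4 + a + b + Fintype.card E) Nat.card_pos (hL.trans (by ring)), hF]
  push_cast
  ring
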